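/- Algebras are non-empty, and of an arbitrary fixed finitary signature. Let $\mathbf M$ be a finite algebra with universe $M$, and let $\mathcal A=\mathbb{ISP}(\mathbf M)$ be the quasivariety generated by $\mathbf M$, i.e. the class of all algebras isomorphic to a subalgebra of a power of $\mathbf M$. Let $\underset{\sim}{\mathbf M}=(M;G,R,\mathscr T)$ be a total alter ego of $\mathbf M$: $\mathscr T$ is the discrete topology, $G$ is a family of (total) finitary operations $M^n\to M$ that are homomorphisms $\mathbf M^n\to\mathbf M$, and $R$ is a family of finitary relations $r\subseteq M^n$ that are (possibly empty) subalgebras of $\mathbf M^n$; there are no partial operations. Let $\mathcal X=\mathbb{IS}_c\mathbb P^+(\underset{\sim}{\mathbf M})$ be the class of topological structures isomorphic to a topologically closed, possibly empty, substructure of a power of $\underset{\sim}{\mathbf M}$ with non-empty index set; its morphisms are the continuous maps preserving all operations and relations. For $\mathbf A\in\mathcal A$ let $D(\mathbf A)=\mathcal A(\mathbf A,\mathbf M)$, as a closed substructure of $\underset{\sim}{\mathbf M}^{A}$; for $\mathbf X\in\mathcal X$ let $E(\mathbf X)=\mathcal X(\mathbf X,\underset{\sim}{\mathbf M})$, as a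 subalgebra of $\mathbf M^{X}$; and let $e_{\mathbf A}\colon\mathbf A\to ED(\mathbf A)$ be the evaluation map $e_{\mathbf A}(a)(x)=x(a)$. Suppose that $\underset{\sim}{\mathbf M}$ yields a strong duality on $\mathcal A$, that is: 1. (duality) $e_{\mathbf A}$ is an isomorphism for every $\mathbf A\in\mathcal A$; 2. (fullness) $DE(\mathbf X)\cong\mathbf X$ for every $\mathbf X\in\mathcal X$; 3. (injectivity) $\underset{\sim}{\mathbf M}$ is injective in $\mathcal X$: for every $\mathbf X\in\mathcal X$ and every closed substructure $\mathbf Y$ of $\mathbf X$, each morphism $\mathbf Y\to\underset{\sim}{\mathbf M}$ extends to a morphism $\mathbf X\to\underset{\sim}{\mathbf M}$. Then $\mathcal A$ has the amalgamation property: for all $\mathbf A,\mathbf B,\mathbf C\in\mathcal A$ and all embeddings $f_B\colon\mathbf A\to\mathbf B$ and $f_C\colon\mathbf A\to\mathbf C$ there are an algebra $\mathbf D\in\mathcal A$ and embeddings $h_B\colon\mathbf B\to\mathbf D$ and $h_C\colon\mathbf C\to\mathbf D$ with $h_B\circ f_B=h_C\circ f_C$. -/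

import Mathlib

open FirstOrder FirstOrder.Language CategoryTheory

universe u u₁ v₁ u₂ v₂

namespace NaturalDuality

/-- The power `N ^ S` of a structure, with operations and relations defined pointwise. -/
instance powerStructure (K : FirstOrder.Language.{u₁, v₁}) (N : Type*) [K.Structure N] (S : Type*) :
    K.Structure (S → N) where
  funMap f x := fun s => Structure.funMap f (fun i => x i s)
  RelMap r x := ∀ s, Structure.RelMap r (fun i => x i s)

/-- The class `ISP(M)` of (non-empty) algebras isomorphic to a subalgebra of a power of `M`.
The power indexed by the empty set is allowed. -/
def ISP (L : FirstOrder.Language.{u₁, v₁}) (M : Type u) [L.Structure M] :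
    Set (Bundled.{u} L.Structure) :=
  {A | Nonempty A ∧ ∃ (I : Type u) (B : L.Substructure (I → M)), Nonempty (A ≃[L] B)}

/-- Two topological structures are isomorphic: there is an isomorphism of structures between them
which is a homeomorphism. -/
def TopIsomorphic (L' : FirstOrder.Language.{u₂, v₂}) (X Y : Type*) [TopologicalSpace X] [L'.Structure X]
    [TopologicalSpace Y] [L'.Structure Y] : Prop :=
  ∃ e : X ≃[L'] Y, IsHomeomorph e

/-- The class of topological structures isomorphic to a topologically closed (possibly empty)
substructure of a power of `M` with non-empty index set, in the product topology. -/
def InIScP (L' : FirstOrder.Language.{u₂, v₂}) (M : Type u) [L'.Structure M] [TopologicalSpace M]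
    (X : Type u) [TopologicalSpace X] [L'.Structure X] : Prop :=
  ∃ (S : Type u) (Y : L'.Substructure (S → M)),
    Nonempty S ∧ IsClosed (Y : Set (S → M)) ∧ TopIsomorphic L' X Y

/-- The total structure given by the `L'`-operations and `L'`-relations on `M` is algebraic over
the algebra given by the `L`-operations on `M`: every `n`-ary `L'`-operation is a homomorphism
`M ^ n → M` of `L`-algebras (equivalently, its graph is a subalgebra of `M ^ (n + 1)`), and every
`n`-ary `L'`-relation is a subalgebra of `M ^ n`. With the discrete topology on `M`, this says that
the total structure is an alter ego of the algebra. There are no partial operations. -/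
structure TotalAlterEgo (L : FirstOrder.Language.{u₁, v₁}) (L' : FirstOrder.Language.{u₂, v₂}) (M : Type u)
    [L.Structure M] [L'.Structure M] : Prop where
  comm : ∀ {n k : ℕ} (g : L'.Functions n) (f : L.Functions k) (x : Fin k → Fin n → M),
    Structure.funMap g (fun j => Structure.funMap f (fun i => x i j)) =
      Structure.funMap f (fun i => Structure.funMap g (x i))
  rel : ∀ {n k : ℕ} (r : L'.Relations n) (f : L.Functions k) (x : Fin k → Fin n → M),
    (∀ i, Structure.RelMap r (x i)) →
      Structure.RelMap r (fun j => Structure.funMap f (fun i => x i j))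

namespace TotalAlterEgo

variable {L : FirstOrder.Language.{u₁, v₁}} [L.IsAlgebraic] {L' : FirstOrder.Language.{u₂, v₂}} {M : Type u}
  [L.Structure M] [L'.Structure M]

/-- The dual `D(A)` of an algebra `A`: the set of homomorphisms `A → M`, as a substructure of the
power `M ^ A` of the alter ego (its topology is the subspace topology). -/
def D (h : TotalAlterEgo L L' M) (A : Type*) [L.Structure A] : L'.Substructure (A → M) where
  carrier := {x | ∃ φ : A →[L] M, ⇑φ = x}
  fun_mem := by
    intro n g x hx
    choose φ hφ using hx
    refine ⟨⟨fun a => Structure.funMap g (fun j => φ j a), ?_, fun r => isEmptyElim r⟩, ?_⟩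
    · intro k f a
      have := h.comm g f (fun i j => φ j (a i))
      simpa [Function.comp_def] using this
    · funext a
      simp [← hφ, Structure.funMap]
      rfl

variable [TopologicalSpace M] [DiscreteTopology M]

/-- The algebra `E(X)` of a topological structure `X`: the set of morphisms (continuous maps
preserving operations and relations) from `X` to the alter ego, as a subalgebra of `M ^ X`. -/
def E (h : TotalAlterEgo L L' M) (X : Type*) [TopologicalSpace X] [L'.Structure X] :
    L.Substructure (X → M) where
  carrier := {α | ∃ φ : X →[L'] M, Continuous φ ∧ ⇑φ = α}
  fun_mem := by
    intro k f α hα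
    choose φ hc hφ using hα
    refine ⟨⟨fun x => Structure.funMap f (fun i => φ i x), ?_, ?_⟩, ?_, ?_⟩
    · intro n g x
      have := h.comm g f (fun i j => φ i (x j))
      simpa [Function.comp_def] using this.symm
    · intro n r x hx
      exact h.rel r f (fun i j => φ i (x j)) (fun i => (φ i).map_rel r x hx)
    · exact (continuous_of_discreteTopology (f := fun y : Fin k → M => Structure.funMap f y)).comp
        (continuous_pi hc)
    · funext x
      simp [← hφ, Structure.funMap]
      rfl

/-- The evaluation homomorphism `e_A : A → E(D(A))`, `e_A(a)(x) = x(a)`. -/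
def e (h : TotalAlterEgo L L' M) (A : Type*) [L.Structure A] : A →[L] h.E (h.D A) where
  toFun a := ⟨fun x => x.1 a,
    ⟨⟨fun x => x.1 a, fun _ _ => rfl, fun _ _ hx => hx a⟩,
      (continuous_apply a).comp continuous_subtype_val, rfl⟩⟩
  map_fun' := by
    intro n f a
    apply Subtype.ext
    funext x
    obtain ⟨x, φ, rfl⟩ := x
    exact φ.map_fun f a
  map_rel' := fun r => isEmptyElim r

/-- The alter ego yields a duality on `ISP(M)`: each `e_A` is an isomorphism (for algebras, this
means a bijective homomorphism). -/
def YieldsDuality (h : TotalAlterEgo L L' M) : Prop :=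
  ∀ A ∈ ISP L M, Function.Bijective (h.e A)

/-- The alter ego yields a full duality on `ISP(M)`: it yields a duality, and `D(E(X))` is
isomorphic to `X` for each `X` in the topological quasivariety generated by the alter ego. -/
def YieldsFullDuality (h : TotalAlterEgo L L' M) : Prop :=
  h.YieldsDuality ∧
    ∀ (X : Type u) [TopologicalSpace X] [L'.Structure X], InIScP L' M X →
      TopIsomorphic L' (h.D (h.E X)) X

variable (L' M) in
/-- The topological structure `M` is injective in the topological quasivariety it generates:
morphisms into `M` extend along embeddings, that is, from closed substructures. -/
def IsInjective : Prop :=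
  ∀ (X : Type u) [TopologicalSpace X] [L'.Structure X], InIScP L' M X →
    ∀ Y : L'.Substructure X, IsClosed (Y : Set X) →
      ∀ α : Y →[L'] M, Continuous α →
        ∃ β : X →[L'] M, Continuous β ∧ ∀ y : Y, β y = α y

/-- The alter ego yields a strong duality on `ISP(M)`: it yields a full duality, and it is
injective in the topological quasivariety it generates. -/
def YieldsStrongDuality (h : TotalAlterEgo L L' M) : Prop :=
  h.YieldsFullDuality ∧ IsInjective L' M

end TotalAlterEgo

end NaturalDuality

/-! Strong duality makes `M` injective among the algebras of `ISP(M)` (`exists_extension`). For an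
embedding `f : A → B`, let `Y` be the set of restrictions to `A` of homomorphisms `B → M`.
Injectivity of the alter ego and duality for `A` show that every morphism `Y → M` is evaluation at a
unique point of `A`, so `E(Y)` is a copy of `A`. By fullness (`exists_eq_eval`) a homomorphism `A →
M` is then evaluation at a point of `Y`, which is to say that it extends to `B`. Amalgamation
follows: each homomorphism from `B` or `C` to `M` belongs to a pair agreeing on `A`, and such pairs
separate points. -/

namespace NaturalDuality

section Power

variable {K : FirstOrder.Language.{u₁, v₁}} {N : Type*} [K.Structure N]

/-- A coordinate projection of a power. -/
def powerProj (K : FirstOrder.Language.{u₁, v₁}) (N : Type*) [K.Structure N] {S : Type*} (s : S) :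
    (S → N) →[K] N where
  toFun x := x s
  map_fun' := fun _ _ => rfl
  map_rel' := fun _ _ hx => hx s

/-- Precomposition with a map of index sets, as a homomorphism of powers. -/
def powerPrecomp (K : FirstOrder.Language.{u₁, v₁}) (N : Type*) [K.Structure N] {S T : Type*}
    (f : S → T) : (T → N) →[K] (S → N) where
  toFun x := x ∘ f
  map_fun' := fun _ _ => rfl
  map_rel' := fun _ _ hx s => hx (f s)

end Power

section ISP

variable {L : FirstOrder.Language.{u₁, v₁}} {M : Type u} [L.Structure M]

/-- Homomorphisms into `M` separate the points of an algebra in `ISP(M)`. -/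
theorem eq_of_forall_hom_eq {A : Bundled.{u} L.Structure} (hA : A ∈ ISP L M) {a b : A}
    (hab : ∀ φ : A →[L] M, φ a = φ b) : a = b := by
  obtain ⟨-, I, B, ⟨k⟩⟩ := hA
  apply k.injective
  apply Subtype.ext
  funext i
  exact hab ((powerProj L M i).comp (B.subtype.toHom.comp k.toHom))

theorem substructure_mem_ISP {S : Type u} (B : L.Substructure (S → M)) (hB : Nonempty B) :
    (⟨B, inferInstance⟩ : Bundled.{u} L.Structure) ∈ ISP L M :=
  ⟨hB, S, B, ⟨FirstOrder.Language.Equiv.refl L B⟩⟩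

theorem power_mem_ISP [Nonempty M] (S : Type u) :
    (⟨S → M, inferInstance⟩ : Bundled.{u} L.Structure) ∈ ISP L M :=
  ⟨inferInstanceAs (Nonempty (S → M)), S, ⊤, ⟨(Substructure.topEquiv (L := L)).symm⟩⟩

/-- An injective homomorphism of algebras is an embedding. -/
def embeddingOfInjective [L.IsAlgebraic] {A B : Type*} [L.Structure A] [L.Structure B]
    (φ : A →[L] B) (hφ : Function.Injective φ) : A ↪[L] B where
  toFun := φ
  inj' := hφ
  map_fun' := φ.map_fun'
  map_rel' := fun r => isEmptyElim r

end ISP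

section InIScP

variable {L' : FirstOrder.Language.{u₂, v₂}} {M : Type u} [L'.Structure M] [TopologicalSpace M]

theorem inIScP_of_isClosed {S : Type u} [Nonempty S] (Y : L'.Substructure (S → M))
    (hY : IsClosed (Y : Set (S → M))) : InIScP L' M Y :=
  ⟨S, Y, ‹_›, hY, FirstOrder.Language.Equiv.refl L' Y, (Homeomorph.refl Y).isHomeomorph⟩

theorem inIScP_power (S : Type u) [Nonempty S] : InIScP L' M (S → M) :=
  ⟨S, ⊤, ‹_›, isClosed_univ, (Substructure.topEquiv (L := L')).symm,
    (Homeomorph.Set.univ (S → M)).symm.isHomeomorph⟩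

end InIScP

namespace TotalAlterEgo

variable {L : FirstOrder.Language.{u₁, v₁}} [L.IsAlgebraic] {L' : FirstOrder.Language.{u₂, v₂}}
  {M : Type u} [L.Structure M] [L'.Structure M] [TopologicalSpace M] [DiscreteTopology M]

/-- The dual of an algebra is closed in the power of the alter ego. -/
theorem isClosed_D (h : TotalAlterEgo L L' M) (A : Type*) [L.Structure A] :
    IsClosed (h.D A : Set (A → M)) := by
  -- Each single homomorphism equation involves finitely many coordinates, so it is a closed
  -- condition.
  have hD : (h.D A : Set (A → M)) = ⋂ (n : ℕ) (f : L.Functions n) (a : Fin n → A),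
      {x | x (Structure.funMap f a) = Structure.funMap f (fun i => x (a i))} := by
    ext x
    simp only [Set.mem_iInter, Set.mem_ofPred_eq]
    constructor
    · rintro ⟨φ, rfl⟩ n f a
      exact φ.map_fun f a
    · intro hx
      exact ⟨⟨x, fun {n} f a => hx n f a, fun r => isEmptyElim r⟩, rfl⟩
  rw [hD]
  refine isClosed_iInter fun n => isClosed_iInter fun f => isClosed_iInter fun a => ?_
  refine isClosed_eq (continuous_apply _) ?_
  exact (continuous_of_discreteTopology (f := fun y : Fin n → M => Structure.funMap f y)).comp
    (continuous_pi fun i => continuous_apply (a i))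

/-- Composition with a continuous homomorphism, as a homomorphism between the algebras `E`. -/
def mapE (h : TotalAlterEgo L L' M) {X Y : Type*} [TopologicalSpace X] [L'.Structure X]
    [TopologicalSpace Y] [L'.Structure Y] (k : X →[L'] Y) (hk : Continuous k) :
    h.E Y →[L] h.E X where
  toFun α := ⟨fun x => α.1 (k x), by
    obtain ⟨α, φ, hφ, rfl⟩ := α
    exact ⟨φ.comp k, hφ.comp hk, rfl⟩⟩
  map_fun' := fun _ _ => rfl
  map_rel' := fun r => isEmptyElim r

omit [L.IsAlgebraic] in
/-- The algebra `E(X)` of a structure in the topological quasivariety is non-empty. -/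
theorem nonempty_E (h : TotalAlterEgo L L' M) {X : Type u} [TopologicalSpace X] [L'.Structure X]
    (hX : InIScP L' M X) : Nonempty (h.E X) := by
  obtain ⟨S, Y, ⟨s⟩, -, k, hk⟩ := hX
  exact ⟨⟨fun x => (k x).1 s, (powerProj L' M s).comp (Y.subtype.toHom.comp k.toHom),
    (continuous_apply s).comp (continuous_subtype_val.comp hk.continuous), rfl⟩⟩

/-- Under a full duality, every homomorphism `E(X) → M` is the evaluation at a point of `X`. -/
theorem YieldsFullDuality.exists_eq_eval {h : TotalAlterEgo L L' M} (hs : h.YieldsFullDuality)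
    {X : Type u} [TopologicalSpace X] [L'.Structure X] (hX : InIScP L' M X)
    (ψ : h.E X →[L] M) : ∃ x : X, ∀ α : h.E X, ψ α = α.1 x := by
  obtain ⟨k, hk⟩ := hs.2 X hX
  have he := hs.1 _ (substructure_mem_ISP (h.E X) (h.nonempty_E hX))
  have hk' : Continuous k.symm := by
    have : (k.symm : X → h.D (h.E X)) = hk.homeomorph.symm := by
      funext x
      apply k.injective
      rw [k.apply_symm_apply]
      exact (hk.homeomorph.apply_symm_apply x).symm
    rw [this]
    exact hk.homeomorph.symm.continuous
  -- Fullness gives only some isomorphism `k`, not necessarily evaluation, so `ψ` is transported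
  -- along `k` before duality for `E(X)` is applied.
  let χ : h.E (h.D (h.E X)) →[L] M := ψ.comp (h.mapE k.symm.toHom hk')
  refine ⟨k ⟨χ.comp (h.e (h.E X)), χ.comp (h.e (h.E X)), rfl⟩, fun α => ?_⟩
  obtain ⟨a, ha⟩ := he.2 (h.mapE k.toHom hk.continuous α)
  have hα : h.mapE k.symm.toHom hk' (h.mapE k.toHom hk.continuous α) = α := by
    apply Subtype.ext
    funext x
    exact congrArg α.1 (k.apply_symm_apply x)
  have h1 : ∀ z, α.1 (k z) = z.1 a := fun z => (congrFun (congrArg Subtype.val ha) z).symm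
  rw [h1]
  change ψ α = ψ (h.mapE k.symm.toHom hk' (h.e (h.E X) a))
  conv_lhs => rw [← hα]
  exact congrArg (fun γ => ψ (h.mapE k.symm.toHom hk' γ)) ha.symm

/-- Under a strong duality, homomorphisms into `M` extend along embeddings of algebras in
`ISP(M)`. -/
theorem YieldsStrongDuality.exists_extension [Finite M] {h : TotalAlterEgo L L' M}
    (hs : h.YieldsStrongDuality) {A B : Bundled.{u} L.Structure} (hA : A ∈ ISP L M)
    (hB : B ∈ ISP L M) (f : A ↪[L] B) (φ : A →[L] M) :
    ∃ ψ : B →[L] M, ∀ a, ψ (f a) = φ a := by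
  have : Nonempty A := hA.1
  -- All operations being total, the image of a substructure is again a substructure.
  let Y : L'.Substructure (A → M) := (h.D B).map (powerPrecomp L' M f)
  have hYc : IsClosed (Y : Set (A → M)) := by
    have hcont : Continuous (powerPrecomp L' M f) := continuous_pi fun a => continuous_apply (f a)
    exact ((h.isClosed_D B).isCompact.image hcont).isClosed
  have hYmem : ∀ ψ : B →[L] M, (⇑ψ ∘ f) ∈ Y := fun ψ => ⟨ψ, ⟨ψ, rfl⟩, rfl⟩
  have hYhom : ∀ y ∈ Y, ∃ ψ : B →[L] M, y = ⇑ψ ∘ f := by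
    rintro _ ⟨_, ⟨ψ, rfl⟩, rfl⟩
    exact ⟨ψ, rfl⟩
  have huniq : ∀ a b : A, (∀ y ∈ Y, y a = y b) → a = b := fun a b hab =>
    f.injective (eq_of_forall_hom_eq hB fun ψ => hab _ (hYmem ψ))
  have hrep : ∀ γ : h.E Y, ∃ a : A, ∀ y : Y, γ.1 y = y.1 a := by
    rintro ⟨_, γ, hγ, rfl⟩
    -- Extend `γ` to the whole power, then restrict to `D(A)`, which contains `Y`; duality for `A`
    -- applies there.
    obtain ⟨β, hβ, hext⟩ := hs.2 (A → M) (inIScP_power A) Y hYc γ hγ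
    obtain ⟨a, ha⟩ := (hs.1.1 A hA).2 ⟨fun x => β x.1, β.comp (h.D A).subtype.toHom,
      hβ.comp continuous_subtype_val, rfl⟩
    refine ⟨a, fun y => (hext y).symm.trans ?_⟩
    obtain ⟨ψ, hψ⟩ := hYhom y.1 y.2
    exact (congrFun (congrArg Subtype.val ha) ⟨y.1, ψ.comp f.toHom, hψ.symm⟩).symm
  choose r hr using hrep
  -- `r` is a homomorphism because the points of `Y` separate `A`.
  let χ : h.E Y →[L] M :=
    { toFun := fun γ => φ (r γ)
      map_fun' := by
        intro n g γ
        have : r (Structure.funMap g γ) = Structure.funMap g (fun i => r (γ i)) := by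
          refine huniq _ _ fun y hy => ?_
          refine (hr _ ⟨y, hy⟩).symm.trans ?_
          obtain ⟨ψ, rfl⟩ := hYhom y hy
          have h1 : (⇑ψ ∘ f) (Structure.funMap g fun i => r (γ i)) =
              Structure.funMap g (fun i => (⇑ψ ∘ f) (r (γ i))) :=
            (ψ.comp f.toHom).map_fun g _
          rw [h1]
          exact congrArg (Structure.funMap g) (funext fun i => hr (γ i) ⟨_, hy⟩)
        rw [this]
        exact φ.map_fun g _
      map_rel' := fun r => isEmptyElim r }
  obtain ⟨y, hy⟩ := hs.1.exists_eq_eval (inIScP_of_isClosed Y hYc) χ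
  obtain ⟨ψ, hψ⟩ := hYhom y.1 y.2
  refine ⟨ψ, fun a => ?_⟩
  -- Testing `χ` on evaluation at `a` compares `φ a` with `y a = ψ (f a)`.
  let γ : h.E Y := ⟨fun z => z.1 a, (powerProj L' M a).comp Y.subtype.toHom,
    (continuous_apply a).comp continuous_subtype_val, rfl⟩
  have hra : r γ = a := huniq _ _ fun z hz => (hr γ ⟨z, hz⟩).symm
  have h2 : φ (r γ) = y.1 a := hy γ
  rw [hra, hψ] at h2
  exact h2.symm

end TotalAlterEgo

/-- If homomorphisms into `M` extend along embeddings in `ISP(M)`, then `ISP(M)` has the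
amalgamation property: the amalgam is the power of `M` indexed by the compatible pairs of
homomorphisms. -/
theorem amalgamation_of_exists_extension {L : FirstOrder.Language.{u₁, v₁}} [L.IsAlgebraic]
    {M : Type u} [Nonempty M] [L.Structure M]
    (hext : ∀ {A B : Bundled.{u} L.Structure}, A ∈ ISP L M → B ∈ ISP L M → ∀ (f : A ↪[L] B)
      (φ : A →[L] M), ∃ ψ : B →[L] M, ∀ a, ψ (f a) = φ a) :
    Amalgamation (ISP L M) := by
  intro A B C f g hA hB hC
  let I : Type u := {p : {x : B → M // ∃ φ : B →[L] M, ⇑φ = x} ×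
    {x : C → M // ∃ φ : C →[L] M, ⇑φ = x} // ∀ a, p.1.1 (f a) = p.2.1 (g a)}
  let hB' : B →[L] (I → M) :=
    { toFun := fun b p => p.1.1.1 b
      map_fun' := by
        intro n s b
        funext p
        obtain ⟨⟨⟨_, φ, rfl⟩, _⟩, _⟩ := p
        exact φ.map_fun s b
      map_rel' := fun r => isEmptyElim r }
  let hC' : C →[L] (I → M) :=
    { toFun := fun c p => p.1.2.1 c
      map_fun' := by
        intro n s c
        funext p
        obtain ⟨⟨_, ⟨_, φ, rfl⟩⟩, _⟩ := p
        exact φ.map_fun s c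
      map_rel' := fun r => isEmptyElim r }
  have hBinj : Function.Injective hB' := fun b b' hbb => eq_of_forall_hom_eq hB fun φ => by
    obtain ⟨ψ, hψ⟩ := hext hA hC g (φ.comp f.toHom)
    -- Extending `φ ∘ f` along `g` completes `φ` to a compatible pair, that is, a coordinate of the
    -- amalgam.
    exact congrFun hbb ⟨(⟨φ, φ, rfl⟩, ⟨ψ, ψ, rfl⟩), fun a => (hψ a).symm⟩
  have hCinj : Function.Injective hC' := fun c c' hcc => eq_of_forall_hom_eq hC fun φ => by
    obtain ⟨ψ, hψ⟩ := hext hA hB f (φ.comp g.toHom)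
    exact congrFun hcc ⟨(⟨ψ, ψ, rfl⟩, ⟨φ, φ, rfl⟩), hψ⟩
  refine ⟨⟨I → M, inferInstance⟩, embeddingOfInjective hB' hBinj, embeddingOfInjective hC' hCinj,
    power_mem_ISP I, ?_⟩
  ext a : 1
  exact funext fun p : I => p.2 a

end NaturalDuality

theorem lemma6p1 {L : FirstOrder.Language.{u₁, v₁}} [L.IsAlgebraic] {L' : FirstOrder.Language.{u₂, v₂}}
    {M : Type u} [Nonempty M] [Finite M] [L.Structure M] [L'.Structure M]
    [TopologicalSpace M] [DiscreteTopology M]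
    (h : NaturalDuality.TotalAlterEgo L L' M) (hs : h.YieldsStrongDuality) :
    Amalgamation (NaturalDuality.ISP L M) :=
  NaturalDuality.amalgamation_of_exists_extension hs.exists_extension
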